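/- Let $\Omega\subset\mathbb C$ be a nonempty open connected set and $\Omega^*=\{z:\bar z\in\Omega\}$. For a bounded operator $T$ on a complex Hilbert space $\mathcal H$, write $T\in B_1(\Omega)$ if $\Omega\subset\sigma(T)$, the closed linear span of $\bigcup_{w\in\Omega}\ker(T-w)$ is $\mathcal H$, and for every $w\in\Omega$ one has $\operatorname{Ran}(T-w)=\mathcal H$ and $\dim\ker(T-w)=1$. A holomorphic frame $t$ of $E_T$ is a holomorphic function $t:\Omega\to\mathcal H$ such that $t(w)$ spans $\ker(T-w)$ for every $w\in\Omega$. For bounded operators $A$ on $\mathcal H$ and $B$ on $\mathcal H'$ let $\tau_{A,B}(X)=AX-XB$ for $X\in\mathcal L(\mathcal H',\mathcal H)$. Similarity $A\sim B$ means $VA=BV$ for some bounded invertible operator $V$. Let $\mathcal H_0,\mathcal H_1$ be complex separable Hilbert spaces and $T_i\in\mathcal L(\mathcal H_i)\cap B_1(\Omega)$, $i=0,1$. Suppose that $T_i$ is unitarily equivalent to the adjoint $M_z^*$ of the (bounded) operator of multiplication by the coordinate function on a Hilbert space $\mathcal H_{\mathcal K_i}$ of holomorphic functions on $\Omega^*$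 with reproducing kernel $\mathcal K_i(z,w)$. Suppose that functions $e_0,e_1,e_2,\dots$ on $\Omega^*$ form an orthogonal (not necessarily orthonormal) basis of both $\mathcal H_{\mathcal K_0}$ and $\mathcal H_{\mathcal K_1}$, that for some scalars $\alpha_n,\beta_n$ and all $z,w\in\Omega^*$ $$\mathcal K_0(z,w)=\sum_{n=0}^\infty\alpha_n e_n(z)\overline{e_n(w)},\qquad \mathcal K_1(z,w)=\sum_{n=0}^\infty\beta_n e_n(z)\overline{e_n(w)}$$ (unconditionally convergent), and that $$\lim_{\operatorname{dist}(w,\partial\Omega^*)\to0}\mathcal K_i(w,w)=+\infty,\qquad i=0,1.$$ Then: (a) There is an operator $T_s\in B_1(\Omega)$ with $\ker\tau_{T_0,T_s}=\{0\}$ and $\ker\tau_{T_1,T_s}=\{0\}$; moreover $T_s$ can be realized, up to unitary equivalence, both on $\mathcal H_0$ and on $\mathcal H_1$ (each realization having these properties). (b) Let $J:\mathcal H_0\to\mathcal H_1$ be any unitary operator (used to identify $\mathcal H_0$ with $\mathcal H_1$). If there are an isometry $X\in\mathcal L(\mathcal H_1,\mathcal H_0)$, an operator $Y\in\mathcal L(\mathcal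 H_1,\mathcal H_0)$ and holomorphic frames $t_i$ of $E_{T_i}$, $i=0,1$, such that for every $w\in\Omega$ $$X^*t_0(w)=2\,J\,Y\,t_1(w)\quad\text{and}\quad \|t_0(w)\|^2=2\big(\|Y t_1(w)\|^2+\|t_1(w)\|^2\big),$$ then $T_0\sim T_1$. -/

import Mathlib

open scoped ComplexConjugate Topology

noncomputable section

namespace CowenDouglas

/-- The Cowen-Douglas class `B_n(Ω)` of bounded operators on a Hilbert space `H`. -/
structure MemB {H : Type*} [NormedAddCommGroup H] [InnerProductSpace ℂ H]
    (n : ℕ) (Ω : Set ℂ) (T : H →L[ℂ] H) : Prop where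
  subset_spectrum : Ω ⊆ spectrum ℂ T
  dense_span :
    (⨆ w ∈ Ω, LinearMap.ker (T - w • ContinuousLinearMap.id ℂ H).toLinearMap).topologicalClosure = ⊤
  surjective : ∀ w ∈ Ω, Function.Surjective (T - w • ContinuousLinearMap.id ℂ H)
  rank_ker : ∀ w ∈ Ω,
    Module.rank ℂ (LinearMap.ker (T - w • ContinuousLinearMap.id ℂ H).toLinearMap) = (n : Cardinal)

/-- `t` is a holomorphic frame over `Ω` of the line bundle with fibre `ker (T - w)` at `w ∈ Ω`,
for `T` in `B_1(Ω)`. -/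
structure IsHolomorphicFrame {H : Type*} [NormedAddCommGroup H] [InnerProductSpace ℂ H]
    (Ω : Set ℂ) (T : H →L[ℂ] H) (t : ℂ → H) : Prop where
  holomorphic : DifferentiableOn ℂ t Ω
  span_eq : ∀ w ∈ Ω,
    Submodule.span ℂ {t w} = LinearMap.ker (T - w • ContinuousLinearMap.id ℂ H).toLinearMap

/-- The operator `τ_{A,B} : X ↦ A X - X B`; its kernel is the set of bounded operators `X`
with `X B = A X`. -/
def tau {H K : Type*} [NormedAddCommGroup H] [InnerProductSpace ℂ H]
    [NormedAddCommGroup K] [InnerProductSpace ℂ K] (A : H →L[ℂ] H) (B : K →L[ℂ] K) :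
    (K →L[ℂ] H) →ₗ[ℂ] (K →L[ℂ] H) where
  toFun X := A ∘L X - X ∘L B
  map_add' X Y := by
    ext x
    simp only [sub_apply, ContinuousLinearMap.comp_apply, add_apply, map_add]
    abel
  map_smul' c X := by
    ext x
    simp [smul_sub]

/-- Unitary equivalence of operators. -/
def UnitarilyEquivalent {H K : Type*} [NormedAddCommGroup H] [InnerProductSpace ℂ H]
    [NormedAddCommGroup K] [InnerProductSpace ℂ K] (A : H →L[ℂ] H) (B : K →L[ℂ] K) : Prop :=
  ∃ U : H ≃ₗᵢ[ℂ] K, ∀ x, U (A x) = B (U x)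

/-- Similarity of operators. -/
def Similar {H K : Type*} [NormedAddCommGroup H] [InnerProductSpace ℂ H]
    [NormedAddCommGroup K] [InnerProductSpace ℂ K] (A : H →L[ℂ] H) (B : K →L[ℂ] K) : Prop :=
  ∃ V : H ≃L[ℂ] K, ∀ x, V (A x) = B (V x)

/-- The conjugate domain `Ω^* = {z : conj z ∈ Ω}`. -/
def conjDomain (Ω : Set ℂ) : Set ℂ := {z | conj z ∈ Ω}

section FunctionSpaces

variable {D : Set ℂ} (HK : Type*) [NormedAddCommGroup HK] [InnerProductSpace ℂ HK]
  [RKHS ℂ HK D ℂ]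

/-- The reproducing kernel Hilbert space `HK` of functions on `D` consists of holomorphic
functions. -/
def IsAnalyticSpace : Prop :=
  ∀ f : HK, ∃ F : ℂ → ℂ, DifferentiableOn ℂ F D ∧ ∀ z : D, f z = F z

/-- The complex-valued reproducing kernel `K(z, w)` of `HK`. -/
def scalarKernel [CompleteSpace HK] (z w : D) : ℂ := RKHS.kernel HK z w 1

variable {HK} in
/-- The bounded operator `M` on `HK` is multiplication by the coordinate function. -/
def IsMulCoordinate (M : HK →L[ℂ] HK) : Prop :=
  ∀ (f : HK) (z : D), M f z = (z : ℂ) * f z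

/-- `T` is unitarily equivalent to the adjoint of multiplication by the coordinate function
on `HK` (which is required to be a bounded operator on `HK`), `HK` being a space of holomorphic
functions. -/
def IsAdjointMulModel [CompleteSpace HK] {H : Type*} [NormedAddCommGroup H]
    [InnerProductSpace ℂ H] (T : H →L[ℂ] H) : Prop :=
  IsAnalyticSpace HK ∧
    ∃ M : HK →L[ℂ] HK, IsMulCoordinate M ∧ UnitarilyEquivalent T (ContinuousLinearMap.adjoint M)

/-- The functions `e 0, e 1, …` on `D` belong to `HK` and form an orthogonal
(not necessarily orthonormal) basis of it. -/
def IsOrthogonalBasis (e : ℕ → D → ℂ) : Prop :=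
  ∃ f : ℕ → HK, (∀ n z, f n z = e n z) ∧ (∀ n, f n ≠ 0) ∧
    (Pairwise fun m n => inner ℂ (f m) (f n) = 0) ∧
    (Submodule.span ℂ (Set.range f)).topologicalClosure = ⊤

/-- The reproducing kernel of `HK` is `∑ a_n e_n(z) conj (e_n(w))`. -/
def HasDiagonalKernel [CompleteSpace HK] (e : ℕ → D → ℂ) (a : ℕ → ℂ) : Prop :=
  ∀ z w : D, HasSum (fun n => a n * e n z * conj (e n w)) (scalarKernel HK z w)

/-- `K(w, w)` (a nonnegative real number) tends to `+∞` as the distance of `w ∈ D` to the boundary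
of `D` tends to zero. -/
def KernelBlowsUp [CompleteSpace HK] : Prop :=
  Filter.Tendsto (fun w : D => (scalarKernel HK w w).re)
    (Filter.comap (fun w : D => Metric.infDist (w : ℂ) (frontier D)) (𝓝 0)) Filter.atTop

end FunctionSpaces

end CowenDouglas

end

/-! For (a), take `c` times the backward shift, with `c` larger than `‖T₀‖`, `‖T₁‖` and the modulus
of every point of `Ω`. Its eigenvectors over any nonempty open subset of the disc of radius `c` are
total (`memB_smul_backwardShift`), so it lies in `B_1(Ω)` and also in `B_1(A)` for an annulus `A`
outside the discs of radius `‖Tᵢ‖`. An intertwiner sends its eigenvectors over `A` to eigenvectors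
of `Tᵢ` with eigenvalue too large to exist, hence to zero (`ker_tau_eq_bot_of_norm_lt`). The
orthogonal bases supply the shift on both Hilbert spaces.

For (b), the norm identity polarizes to an identity of Gram kernels, since a holomorphic function on
`Ω^* × Ω` is determined by its values at `(conj w, w)` (`eq_zero_of_conj_diagonal`). Thus the norms
of a combination of the `t₀ w` and of the same combination of the `t₁ w` are comparable, and `t₀ w ↦
t₁ w` extends to a bounded invertible map. It intertwines because it matches eigenvectors. -/

/-! ### Polarization of sesquiholomorphic kernels -/

open CowenDouglas Set Filter Metric in
/-- A holomorphic function on a disc about the origin that vanishes at its real points vanishes. -/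
theorem eq_zero_of_forall_ofReal_eq_zero {g : ℂ → ℂ} {r : ℝ} (hr : 0 < r)
    (hg : DifferentiableOn ℂ g (ball 0 r)) (h0 : ∀ x : ℝ, |x| < r → g x = 0) :
    ∀ z ∈ ball (0 : ℂ) r, g z = 0 := by
  have han := hg.analyticOnNhd isOpen_ball
  refine han.eqOn_zero_of_preconnected_of_frequently_eq_zero
    (convex_ball _ _).isPreconnected (mem_ball_self hr) ?_
  have ht : Tendsto (fun x : ℝ => (x : ℂ)) (𝓝[≠] 0) (𝓝[≠] 0) := by
    refine tendsto_nhdsWithin_iff.2 ⟨?_, ?_⟩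
    · exact (Complex.continuous_ofReal.tendsto' 0 0 (by simp)).mono_left nhdsWithin_le_nhds
    · filter_upwards [self_mem_nhdsWithin] with x hx
      simpa using hx
  refine ht.frequently (Eventually.frequently ?_)
  filter_upwards [nhdsWithin_le_nhds (ball_mem_nhds (0 : ℝ) hr)] with x hx
  exact h0 x (by simpa using hx)

open CowenDouglas in
theorem isOpen_conjDomain {Ω : Set ℂ} (h : IsOpen Ω) : IsOpen (conjDomain Ω) :=
  h.preimage Complex.continuous_conj

open CowenDouglas in
theorem isPreconnected_conjDomain {Ω : Set ℂ} (h : IsPreconnected Ω) :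
    IsPreconnected (conjDomain Ω) := by
  have : conjDomain Ω = (fun z : ℂ => conj z) '' Ω := by
    ext z
    constructor
    · intro hz
      exact ⟨conj z, hz, by simp⟩
    · rintro ⟨w, hw, rfl⟩
      simpa [conjDomain] using hw
  rw [this]
  exact h.image _ Complex.continuous_conj.continuousOn

open CowenDouglas Set Filter Metric in
/-- Polarization: a holomorphic function on `Ω^* × Ω` that vanishes on `{(conj w, w)}` vanishes. -/
theorem eq_zero_of_conj_diagonal {Ω : Set ℂ} (ho : IsOpen Ω) (hc : IsConnected Ω)
    {h : ℂ × ℂ → ℂ} (hd : DifferentiableOn ℂ h (conjDomain Ω ×ˢ Ω))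
    (h0 : ∀ w ∈ Ω, h (conj w, w) = 0) :
    ∀ u ∈ conjDomain Ω, ∀ v ∈ Ω, h (u, v) = 0 := by
  obtain ⟨w₀, hw₀⟩ := hc.nonempty
  obtain ⟨δ, hδ, hball⟩ := Metric.isOpen_iff.1 ho w₀ hw₀
  have hball' : ∀ u ∈ ball (conj w₀) δ, u ∈ conjDomain Ω := by
    intro u hu
    apply hball
    rw [mem_ball, Complex.dist_eq] at hu ⊢
    rw [← Complex.norm_conj]
    simpa using hu
  have hr : 0 < δ / 2 := by positivity
  -- In the coordinates `(s, t)` the set `{(conj w, w)}` is the locus where both are real. `hstep`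
  -- and `hlocal` free one coordinate at a time.
  have hmem : ∀ s ∈ ball (0 : ℂ) (δ / 2), ∀ t ∈ ball (0 : ℂ) (δ / 2),
      (conj w₀ + s - Complex.I * t, w₀ + s + Complex.I * t) ∈ conjDomain Ω ×ˢ Ω := by
    intro s hs t ht
    rw [mem_ball_zero_iff] at hs ht
    have hIt : ‖Complex.I * t‖ = ‖t‖ := by simp
    refine ⟨hball' _ ?_, hball ?_⟩
    · rw [mem_ball, Complex.dist_eq, show conj w₀ + s - Complex.I * t - conj w₀
        = s - Complex.I * t by ring]
      linarith [norm_sub_le s (Complex.I * t)]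
    · rw [mem_ball, Complex.dist_eq, show w₀ + s + Complex.I * t - w₀
        = s + Complex.I * t by ring]
      linarith [norm_add_le s (Complex.I * t)]
  have hreal : ∀ s t : ℝ, |s| < δ / 2 → |t| < δ / 2 →
      h (conj w₀ + s - Complex.I * t, w₀ + s + Complex.I * t) = 0 := by
    intro s t hs ht
    have := h0 (w₀ + s + Complex.I * t)
      (hmem s (by simpa using hs) t (by simpa using ht)).2
    simpa [sub_eq_add_neg] using this
  have hstep : ∀ s : ℝ, |s| < δ / 2 → ∀ t ∈ ball (0 : ℂ) (δ / 2),
      h (conj w₀ + s - Complex.I * t, w₀ + s + Complex.I * t) = 0 := by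
    intro s hs
    refine eq_zero_of_forall_ofReal_eq_zero
      (g := fun t => h (conj w₀ + s - Complex.I * t, w₀ + s + Complex.I * t)) hr ?_
      (fun t ht => hreal s t hs ht)
    exact hd.comp (by fun_prop) (fun t ht => hmem s (by simpa using hs) t ht)
  have hlocal : ∀ t ∈ ball (0 : ℂ) (δ / 2), ∀ s ∈ ball (0 : ℂ) (δ / 2),
      h (conj w₀ + s - Complex.I * t, w₀ + s + Complex.I * t) = 0 := by
    intro t ht
    refine eq_zero_of_forall_ofReal_eq_zero
      (g := fun s => h (conj w₀ + s - Complex.I * t, w₀ + s + Complex.I * t)) hr ?_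
      (fun s hs => hstep s hs t ht)
    exact hd.comp (by fun_prop) (fun s hs => hmem s hs t ht)
  have hnear : ∀ u ∈ ball (conj w₀) (δ / 2), ∀ v ∈ ball w₀ (δ / 2), h (u, v) = 0 := by
    intro u hu v hv
    rw [mem_ball, Complex.dist_eq] at hu hv
    have key := hlocal (((v - w₀) - (u - conj w₀)) / (2 * Complex.I)) ?_
      (((v - w₀) + (u - conj w₀)) / 2) ?_
    · convert key using 3
      · field_simp
        ring
      · field_simp
        ring
    · rw [mem_ball_zero_iff, norm_div]
      have := norm_sub_le (v - w₀) (u - conj w₀)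
      simp only [norm_mul, Complex.norm_I, mul_one, Complex.norm_ofNat]
      linarith
    · rw [mem_ball_zero_iff, norm_div]
      have := norm_add_le (v - w₀) (u - conj w₀)
      simp only [Complex.norm_ofNat]
      linarith
  have hright : ∀ u ∈ ball (conj w₀) (δ / 2), ∀ v ∈ Ω, h (u, v) = 0 := by
    intro u hu
    have hud : u ∈ conjDomain Ω := hball' u (ball_subset_ball (by linarith) hu)
    have han : AnalyticOnNhd ℂ (fun v => h (u, v)) Ω :=
      (hd.comp (f := fun v : ℂ => (u, v)) (by fun_prop)
        (fun v hv => ⟨hud, hv⟩)).analyticOnNhd ho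
    exact han.eqOn_zero_of_preconnected_of_eventuallyEq_zero hc.isPreconnected hw₀
      (by filter_upwards [ball_mem_nhds w₀ hr] with v hv using hnear u hu v hv)
  intro u hu v hv
  have han : AnalyticOnNhd ℂ (fun u => h (u, v)) (conjDomain Ω) :=
    (hd.comp (f := fun u : ℂ => (u, v)) (by fun_prop)
      (fun u hu => ⟨hu, hv⟩)).analyticOnNhd (isOpen_conjDomain ho)
  exact han.eqOn_zero_of_preconnected_of_eventuallyEq_zero
    (isPreconnected_conjDomain hc.isPreconnected) (z₀ := conj w₀) (by simpa [conjDomain] using hw₀)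
    (by filter_upwards [ball_mem_nhds (conj w₀) hr] with u hu using hright u hu v hv) hu

open CowenDouglas in
/-- The Gram kernel of a holomorphic vector-valued function is holomorphic on `Ω^* × Ω`. -/
theorem differentiableOn_inner_conj {E : Type*} [NormedAddCommGroup E] [InnerProductSpace ℂ E]
    {Ω : Set ℂ} (ho : IsOpen Ω) {a : ℂ → E} (ha : DifferentiableOn ℂ a Ω) :
    DifferentiableOn ℂ (fun p : ℂ × ℂ => inner ℂ (a (conj p.1)) (a p.2))
      (conjDomain Ω ×ˢ Ω) := by
  rintro ⟨u, v⟩ ⟨hu, hv⟩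
  have h2 : DifferentiableAt ℂ (fun p : ℂ × ℂ => a p.2) (u, v) :=
    DifferentiableAt.comp (u, v) ((ha.differentiableAt (ho.mem_nhds hv)) :
      DifferentiableAt ℂ a (Prod.snd (u, v))) differentiableAt_snd
  -- The two conjugations, of the argument and of the first slot of the inner product, cancel.
  have h1' : DifferentiableAt ℂ (fun z : ℂ => innerSL ℂ (a (conj z))) u := by
    have := (ha.differentiableAt (ho.mem_nhds hu)).comp_semilinear₁ (starRingEnd ℂ)
      (L := innerSL ℂ (E := E))
    simpa [Function.comp_def] using this
  have h1 : DifferentiableAt ℂ (fun p : ℂ × ℂ => innerSL ℂ (a (conj p.1))) (u, v) :=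
    DifferentiableAt.comp (g := fun z : ℂ => innerSL ℂ (a (conj z))) (f := Prod.fst) (u, v) h1'
      differentiableAt_fst
  exact (h1.clm_apply h2).differentiableWithinAt

/-! ### Similarity from the norm identity -/

section Similarity

open CowenDouglas

variable {H₀ H₁ : Type*} [NormedAddCommGroup H₀] [InnerProductSpace ℂ H₀]
  [NormedAddCommGroup H₁] [InnerProductSpace ℂ H₁]

/-- The linear combinations of a frame of `T` are dense if `T` is in the Cowen-Douglas class. -/
theorem CowenDouglas.IsHolomorphicFrame.denseRange {n : ℕ} {Ω : Set ℂ} {T : H₀ →L[ℂ] H₀}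
    (hT : MemB n Ω T) {t : ℂ → H₀} (ht : IsHolomorphicFrame Ω T t) :
    DenseRange (Finsupp.linearCombination ℂ (fun w : Ω => t w)) := by
  have h := hT.dense_span
  rw [DenseRange, ← LinearMap.coe_range, Finsupp.range_linearCombination,
    Submodule.dense_iff_topologicalClosure_eq_top, ← h]
  congr 1
  rw [Submodule.span_range_eq_iSup, iSup_subtype]
  exact iSup_congr fun w => iSup_congr fun hw => ht.span_eq w hw

theorem CowenDouglas.IsHolomorphicFrame.apply_eq {Ω : Set ℂ} {T : H₀ →L[ℂ] H₀}
    {t : ℂ → H₀} (ht : IsHolomorphicFrame Ω T t) {w : ℂ} (hw : w ∈ Ω) : T (t w) = w • t w := by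
  have : t w ∈ LinearMap.ker (T - w • ContinuousLinearMap.id ℂ H₀).toLinearMap := by
    rw [← ht.span_eq w hw]
    exact Submodule.mem_span_singleton_self _
  simpa [sub_eq_zero] using this

/-- Operators of class `B_1` with frames satisfying `‖t₀‖² = 2 (‖Y t₁‖² + ‖t₁‖²)` are similar. -/
theorem similar_of_norm_sq_eq [CompleteSpace H₀] [CompleteSpace H₁] {n : ℕ} {Ω : Set ℂ}
    (ho : IsOpen Ω) (hc : IsConnected Ω)
    {T₀ : H₀ →L[ℂ] H₀} {T₁ : H₁ →L[ℂ] H₁} (hT₀ : MemB n Ω T₀) (hT₁ : MemB n Ω T₁)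
    {t₀ : ℂ → H₀} {t₁ : ℂ → H₁} (ht₀ : IsHolomorphicFrame Ω T₀ t₀)
    (ht₁ : IsHolomorphicFrame Ω T₁ t₁) (Y : H₁ →L[ℂ] H₀)
    (hY : ∀ w ∈ Ω, ‖t₀ w‖ ^ 2 = 2 * (‖Y (t₁ w)‖ ^ 2 + ‖t₁ w‖ ^ 2)) : Similar T₀ T₁ := by
  have hpol : ∀ u ∈ Ω, ∀ v ∈ Ω, inner ℂ (t₀ u) (t₀ v) =
      2 * (inner ℂ (Y (t₁ u)) (Y (t₁ v)) + inner ℂ (t₁ u) (t₁ v)) := by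
    intro u hu v hv
    have hYt : DifferentiableOn ℂ (fun w => Y (t₁ w)) Ω :=
      Y.differentiable.comp_differentiableOn ht₁.holomorphic
    have h := eq_zero_of_conj_diagonal ho hc
      (h := fun p => inner ℂ (t₀ (conj p.1)) (t₀ p.2) -
        2 * (inner ℂ (Y (t₁ (conj p.1))) (Y (t₁ p.2)) + inner ℂ (t₁ (conj p.1)) (t₁ p.2)))
      ((differentiableOn_inner_conj ho ht₀.holomorphic).sub
        (((differentiableOn_inner_conj ho hYt).add
          (differentiableOn_inner_conj ho ht₁.holomorphic)).const_mul 2))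
      (fun w hw => by
        have := congrArg (fun x : ℝ => (x : ℂ)) (hY w hw)
        push_cast at this
        simp only [Complex.conj_conj, inner_self_eq_norm_sq_to_K, Complex.coe_algebraMap]
        rw [this, sub_self])
      (conj u) (by simpa [conjDomain] using hu) v hv
    simpa [sub_eq_zero] using h
  set L₀ := Finsupp.linearCombination ℂ (fun w : Ω => t₀ w)
  set L₁ := Finsupp.linearCombination ℂ (fun w : Ω => t₁ w)
  have hL : ∀ c d, inner ℂ (L₀ c) (L₀ d) =
      2 * (inner ℂ (Y (L₁ c)) (Y (L₁ d)) + inner ℂ (L₁ c) (L₁ d)) := by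
    intro c d
    induction c using Finsupp.induction_linear with
    | zero => simp
    | add c c' hc hc' =>
      simp only [map_add, inner_add_left, hc, hc']
      ring
    | single u a =>
      induction d using Finsupp.induction_linear with
      | zero => simp
      | add d d' hd hd' =>
        simp only [map_add, inner_add_right, hd, hd']
        ring
      | single v b =>
        simp only [L₀, L₁, Finsupp.linearCombination_single, map_smul, inner_smul_left,
          inner_smul_right, hpol u u.2 v v.2]
        ring
  have hnorm : ∀ c, ‖L₀ c‖ ^ 2 = 2 * (‖Y (L₁ c)‖ ^ 2 + ‖L₁ c‖ ^ 2) := by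
    intro c
    have := hL c c
    simp only [inner_self_eq_norm_sq_to_K, Complex.coe_algebraMap] at this
    exact_mod_cast this
  have hD₀ : DenseRange L₀ := ht₀.denseRange hT₀
  have hD₁ : DenseRange L₁ := ht₁.denseRange hT₁
  have hb₁ : ∃ C, ∀ c, ‖L₁ ((LinearEquiv.refl ℂ _) c)‖ ≤ C * ‖L₀ c‖ := by
    refine ⟨1, fun c => ?_⟩
    rw [one_mul, LinearEquiv.refl_apply]
    refine le_of_sq_le_sq ?_ (norm_nonneg _)
    nlinarith [hnorm c, sq_nonneg ‖Y (L₁ c)‖, sq_nonneg ‖L₁ c‖]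
  have hb₀ : ∃ C, ∀ c, ‖L₀ ((LinearEquiv.refl ℂ _).symm c)‖ ≤ C * ‖L₁ c‖ := by
    -- Any constant whose square is at least `2 * (‖Y‖ ^ 2 + 1)` works.
    refine ⟨2 * (‖Y‖ + 1), fun c => ?_⟩
    rw [LinearEquiv.refl_symm, LinearEquiv.refl_apply]
    refine le_of_sq_le_sq ?_ (by positivity)
    have h1 : ‖Y (L₁ c)‖ ^ 2 ≤ (‖Y‖ * ‖L₁ c‖) ^ 2 := by
      gcongr
      exact Y.le_opNorm _
    rw [hnorm c]
    nlinarith [mul_nonneg (norm_nonneg Y) (sq_nonneg ‖L₁ c‖), sq_nonneg ‖L₁ c‖,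
      sq_nonneg (‖Y‖ * ‖L₁ c‖)]
  -- The identity on coefficients; the two bounds make it well defined on vectors as well as bounded
  -- both ways.
  let V : H₀ ≃L[ℂ] H₁ := (LinearEquiv.refl ℂ (Ω →₀ ℂ)).extend L₀ L₁ hD₀ hb₁ hD₁ hb₀
  have hV : ∀ c, V (L₀ c) = L₁ c := fun c =>
    LinearEquiv.extend_eq (LinearEquiv.refl ℂ (Ω →₀ ℂ)) L₀ L₁ hD₀ hb₁ hD₁ hb₀ c
  have hVt : ∀ w : Ω, V (t₀ w) = t₁ w := fun w => by
    simpa [L₀, L₁] using hV (Finsupp.single w 1)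
  refine ⟨V, hD₀.induction ?_ (isClosed_eq (by fun_prop) (by fun_prop))⟩
  rintro _ ⟨c, rfl⟩
  induction c using Finsupp.induction_linear with
  | zero => simp
  | add c c' hc hc' => simp only [map_add, hc, hc']
  | single w a =>
    simp only [L₀, Finsupp.linearCombination_single, map_smul, hVt, ht₀.apply_eq w.2,
      ht₁.apply_eq w.2]

end Similarity

/-! ### Absence of intertwiners -/

open CowenDouglas in
/-- There is no nonzero intertwiner from `S` to `T` if `S` is of class `B_n(Ω)` with all points of
`Ω` of modulus larger than `‖T‖`. -/
theorem ker_tau_eq_bot_of_norm_lt {H K : Type*} [NormedAddCommGroup H]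
    [InnerProductSpace ℂ H] [NormedAddCommGroup K] [InnerProductSpace ℂ K] {n : ℕ} {Ω : Set ℂ} {S : H →L[ℂ] H} (hS : MemB n Ω S)
    {T : K →L[ℂ] K} (hT : ∀ w ∈ Ω, ‖T‖ < ‖w‖) : LinearMap.ker (tau T S) = ⊥ := by
  rw [Submodule.eq_bot_iff]
  intro X hX
  have hX' : ∀ x, T (X x) = X (S x) := fun x =>
    sub_eq_zero.1 (DFunLike.congr_fun (LinearMap.mem_ker.1 hX) x)
  have hle : (⨆ w ∈ Ω, LinearMap.ker (S - w • ContinuousLinearMap.id ℂ H).toLinearMap) ≤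
      LinearMap.ker X.toLinearMap := by
    refine iSup₂_le fun w hw x hx => ?_
    have hSx : S x = w • x := by
      simpa [sub_eq_zero] using hx
    have h1 := hX' x
    rw [hSx, map_smul] at h1
    have h2 := T.le_opNorm (X x)
    rw [h1, norm_smul] at h2
    by_contra hne
    exact absurd h2 (not_le.2 (mul_lt_mul_of_pos_right (hT w hw) (norm_pos_iff.2 hne)))
  have htop := Submodule.topologicalClosure_minimal _ hle X.isClosed_ker
  rw [hS.dense_span] at htop
  ext x
  exact htop Submodule.mem_top

/-! ### The backward shift and its eigenvectors -/

theorem HilbertBasis.orthonormal_succ {H : Type*} [NormedAddCommGroup H]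
    [InnerProductSpace ℂ H] (b : HilbertBasis ℕ ℂ H) :
    Orthonormal ℂ fun n => b (n + 1) :=
  b.orthonormal.comp _ (add_left_injective 1)

section Shift

open CowenDouglas Metric ContinuousLinearMap

variable {H K : Type*} [NormedAddCommGroup H] [InnerProductSpace ℂ H] [CompleteSpace H]
  [NormedAddCommGroup K] [InnerProductSpace ℂ K]

/-- The forward shift along a Hilbert basis indexed by `ℕ`. -/
noncomputable def forwardShift (b : HilbertBasis ℕ ℂ H) : H →L[ℂ] H :=
  (b.orthonormal_succ.orthogonalFamily.linearIsometry.comp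
    b.repr.toLinearIsometry).toContinuousLinearMap

/-- The backward shift along a Hilbert basis indexed by `ℕ`. -/
noncomputable def backwardShift (b : HilbertBasis ℕ ℂ H) : H →L[ℂ] H :=
  adjoint (forwardShift b)

theorem forwardShift_basis (b : HilbertBasis ℕ ℂ H) (n : ℕ) :
    forwardShift b (b n) = b (n + 1) := by
  have := b.orthonormal_succ.orthogonalFamily.linearIsometry_apply_single (i := n) (1 : ℂ)
  rw [LinearIsometry.toSpanSingleton_apply, one_smul] at this
  rw [← this, ← b.repr_self]
  rfl

theorem norm_forwardShift_apply (b : HilbertBasis ℕ ℂ H) (x : H) : ‖forwardShift b x‖ = ‖x‖ := by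
  simp [forwardShift]

theorem repr_backwardShift (b : HilbertBasis ℕ ℂ H) (x : H) (n : ℕ) :
    b.repr (backwardShift b x) n = b.repr x (n + 1) := by
  rw [b.repr_apply_apply, b.repr_apply_apply, backwardShift, adjoint_inner_right,
    forwardShift_basis]

theorem backwardShift_forwardShift (b : HilbertBasis ℕ ℂ H) (x : H) :
    backwardShift b (forwardShift b x) = x :=
  DFunLike.congr_fun ((norm_map_iff_adjoint_comp_self _).1 (norm_forwardShift_apply b)) x

theorem backwardShift_basis_zero (b : HilbertBasis ℕ ℂ H) : backwardShift b (b 0) = 0 := by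
  apply b.repr.injective
  ext n
  rw [repr_backwardShift, b.repr_apply_apply, b.orthonormal.inner_eq_zero (Nat.succ_ne_zero n)]
  simp

theorem sub_forwardShift_backwardShift (b : HilbertBasis ℕ ℂ H) (x : H) :
    x - forwardShift b (backwardShift b x) = b.repr x 0 • b 0 := by
  apply b.repr.injective
  ext n
  rw [map_sub, map_smul, lp.coeFn_sub, lp.coeFn_smul, Pi.sub_apply, Pi.smul_apply]
  rcases n with _ | n
  · rw [b.repr_apply_apply (forwardShift b _), ← adjoint_inner_left, ← backwardShift,
      backwardShift_basis_zero, b.repr_apply_apply (b 0),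
      orthonormal_iff_ite.1 b.orthonormal]
    simp
  · rw [← repr_backwardShift b (forwardShift b _), backwardShift_forwardShift,
      repr_backwardShift, b.repr_apply_apply (b 0),
      b.orthonormal.inner_eq_zero (Nat.succ_ne_zero n)]
    simp

/-- The eigenvector of the backward shift for the eigenvalue `z`, `‖z‖ < 1`. -/
noncomputable def shiftEigenvector (b : HilbertBasis ℕ ℂ H) (z : ℂ) : H :=
  Ring.inverse (1 - z • forwardShift b) (b 0)

theorem isUnit_one_sub_smul_forwardShift (b : HilbertBasis ℕ ℂ H) {z : ℂ} (hz : ‖z‖ < 1) :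
    IsUnit (1 - z • forwardShift b) := by
  refine isUnit_one_sub_of_norm_lt_one (lt_of_le_of_lt ?_ hz)
  refine opNorm_le_bound _ (norm_nonneg _) fun x => ?_
  rw [smul_apply, norm_smul, norm_forwardShift_apply]

theorem eq_smul_shiftEigenvector (b : HilbertBasis ℕ ℂ H) {z : ℂ} (hz : ‖z‖ < 1) {x : H} {a : ℂ}
    (h : x - z • forwardShift b x = a • b 0) : x = a • shiftEigenvector b z := by
  have := DFunLike.congr_fun (Ring.inverse_mul_cancel _ (isUnit_one_sub_smul_forwardShift b hz)) x
  rw [shiftEigenvector, ← map_smul, ← h]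
  exact this.symm

theorem shiftEigenvector_eq (b : HilbertBasis ℕ ℂ H) {z : ℂ} (hz : ‖z‖ < 1) :
    shiftEigenvector b z = b 0 + z • forwardShift b (shiftEigenvector b z) := by
  have := DFunLike.congr_fun
    (Ring.mul_inverse_cancel _ (isUnit_one_sub_smul_forwardShift b hz)) (b 0)
  exact sub_eq_iff_eq_add.1 this

theorem shiftEigenvector_ne_zero (b : HilbertBasis ℕ ℂ H) {z : ℂ} (hz : ‖z‖ < 1) :
    shiftEigenvector b z ≠ 0 := by
  intro h
  have := shiftEigenvector_eq b hz
  rw [h, map_zero (forwardShift b), smul_zero, add_zero] at this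
  exact b.orthonormal.ne_zero 0 this.symm

theorem backwardShift_shiftEigenvector (b : HilbertBasis ℕ ℂ H) {z : ℂ} (hz : ‖z‖ < 1) :
    backwardShift b (shiftEigenvector b z) = z • shiftEigenvector b z := by
  conv_lhs => rw [shiftEigenvector_eq b hz]
  rw [map_add, map_smul, backwardShift_basis_zero, backwardShift_forwardShift, zero_add]

theorem differentiableOn_shiftEigenvector (b : HilbertBasis ℕ ℂ H) :
    DifferentiableOn ℂ (shiftEigenvector b) (ball 0 1) := by
  intro z hz
  have h : DifferentiableAt ℂ (fun z : ℂ => (1 : H →L[ℂ] H) - z • forwardShift b) z := by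
    fun_prop
  have h' := (differentiableAt_inverse (𝕜 := ℂ) (isUnit_one_sub_smul_forwardShift b
    (mem_ball_zero_iff.1 hz))).comp z h
  exact (h'.clm_apply (differentiableAt_const (b 0))).differentiableWithinAt

/-- Pairing with the eigenvectors turns `x` into a holomorphic function of `z`; the backward shift
of `x` removes its constant term and divides by `z`. -/
theorem inner_shiftEigenvector (b : HilbertBasis ℕ ℂ H) {z : ℂ} (hz : ‖z‖ < 1) (x : H) :
    inner ℂ x (shiftEigenvector b z) =
      inner ℂ x (b 0) + z * inner ℂ (backwardShift b x) (shiftEigenvector b z) := by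
  conv_lhs => rw [shiftEigenvector_eq b hz]
  rw [inner_add_right, inner_smul_right, backwardShift, adjoint_inner_left]

open Filter in
/-- The eigenvectors of the backward shift for the eigenvalues in an open set are total. -/
theorem eq_zero_of_inner_shiftEigenvector_eq_zero (b : HilbertBasis ℕ ℂ H) {U : Set ℂ}
    (ho : IsOpen U) (hne : U.Nonempty) (hU : U ⊆ ball 0 1) {x : H}
    (hx : ∀ z ∈ U, inner ℂ x (shiftEigenvector b z) = 0) : x = 0 := by
  obtain ⟨z₀, hz₀⟩ := hne
  have han : ∀ y : H, AnalyticOnNhd ℂ (fun z => inner ℂ y (shiftEigenvector b z)) (ball 0 1) :=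
    fun y => ((innerSL ℂ y).differentiable.comp_differentiableOn
      (differentiableOn_shiftEigenvector b)).analyticOnNhd isOpen_ball
  have hpre : IsPreconnected (ball (0 : ℂ) 1) := (convex_ball _ _).isPreconnected
  have hx1 : ∀ z ∈ ball (0 : ℂ) 1, inner ℂ x (shiftEigenvector b z) = 0 :=
    (han x).eqOn_zero_of_preconnected_of_eventuallyEq_zero hpre (hU hz₀)
      (by filter_upwards [ho.mem_nhds hz₀] with z hz using hx z hz)
  have h0 : ∀ y : H, (∀ z ∈ ball (0 : ℂ) 1, inner ℂ y (shiftEigenvector b z) = 0) →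
      inner ℂ y (b 0) = 0 := by
    intro y hy
    have := inner_shiftEigenvector b (z := 0) (by simp) y
    rw [hy 0 (by simp)] at this
    simpa using this.symm
  have hstep : ∀ y : H, (∀ z ∈ ball (0 : ℂ) 1, inner ℂ y (shiftEigenvector b z) = 0) →
      ∀ z ∈ ball (0 : ℂ) 1, inner ℂ (backwardShift b y) (shiftEigenvector b z) = 0 := by
    intro y hy
    -- Division by `z` is possible only off the origin; the identity theorem covers the origin.
    refine (han _).eqOn_zero_of_preconnected_of_frequently_eq_zero hpre
      (mem_ball_self one_pos) (Eventually.frequently ?_)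
    filter_upwards [nhdsWithin_le_nhds (ball_mem_nhds (0 : ℂ) one_pos), self_mem_nhdsWithin]
      with z hz hz0
    have := inner_shiftEigenvector b (mem_ball_zero_iff.1 hz) y
    rw [hy z hz, h0 y hy, zero_add] at this
    exact (mul_eq_zero.1 this.symm).resolve_left hz0
  have hall : ∀ n, ∀ y : H, (∀ z ∈ ball (0 : ℂ) 1, inner ℂ y (shiftEigenvector b z) = 0) →
      b.repr y n = 0 := by
    intro n
    induction n with
    | zero =>
      intro y hy
      rw [b.repr_apply_apply, ← inner_conj_symm, h0 y hy, map_zero]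
    | succ n ih =>
      intro y hy
      rw [← repr_backwardShift]
      exact ih _ (hstep y hy)
  apply b.repr.injective
  ext n
  simpa using hall n x hx1

/-- With `S` the forward and `B` the backward shift, `1 - S B` projects onto `b 0`. So `B x = z • x`
gives `(1 - z S) x ∈ ℂ b 0`, and `1 - z S` is invertible. -/
theorem ker_smul_backwardShift_sub (b : HilbertBasis ℕ ℂ H) {c : ℝ} (hc : 0 < c) {w : ℂ}
    (hw : ‖w‖ < c) :
    LinearMap.ker ((c : ℂ) • backwardShift b - w • ContinuousLinearMap.id ℂ H).toLinearMap =
      Submodule.span ℂ {shiftEigenvector b (w / c)} := by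
  have hc' : (c : ℂ) ≠ 0 := by exact_mod_cast hc.ne'
  have hz : ‖w / c‖ < 1 := by
    rw [norm_div, Complex.norm_real, Real.norm_of_nonneg hc.le]
    exact (div_lt_one hc).2 hw
  ext x
  rw [Submodule.mem_span_singleton, LinearMap.mem_ker]
  have hiff : ((c : ℂ) • backwardShift b - w • ContinuousLinearMap.id ℂ H).toLinearMap x = 0 ↔
      backwardShift b x = (w / c) • x := by
    rw [coe_coe, sub_apply, sub_eq_zero, smul_apply, smul_apply, coe_id', id_eq, div_eq_inv_mul,
      mul_smul, eq_inv_smul_iff₀ hc']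
  rw [hiff]
  constructor
  · intro h
    refine ⟨b.repr x 0, (eq_smul_shiftEigenvector b hz ?_).symm⟩
    rw [← sub_forwardShift_backwardShift, h, map_smul]
  · rintro ⟨a, rfl⟩
    rw [map_smul, backwardShift_shiftEigenvector b hz, smul_comm]

/-- A positive multiple `c` of the backward shift belongs to `B_1(Ω)` for each nonempty open subset
`Ω` of the disc of radius `c`. -/
theorem memB_smul_backwardShift (b : HilbertBasis ℕ ℂ H) {c : ℝ} (hc : 0 < c) {Ω : Set ℂ}
    (ho : IsOpen Ω) (hne : Ω.Nonempty) (hΩ : Ω ⊆ ball 0 c) :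
    MemB 1 Ω ((c : ℂ) • backwardShift b) := by
  have hc' : (c : ℂ) ≠ 0 := by exact_mod_cast hc.ne'
  have hz : ∀ w ∈ Ω, ‖w / c‖ < 1 := fun w hw => by
    rw [norm_div, Complex.norm_real, Real.norm_of_nonneg hc.le]
    exact (div_lt_one hc).2 (mem_ball_zero_iff.1 (hΩ hw))
  have hker := fun w (hw : w ∈ Ω) =>
    ker_smul_backwardShift_sub b hc (mem_ball_zero_iff.1 (hΩ hw))
  refine ⟨fun w hw => ?_, ?_, fun w hw => ?_, fun w hw => ?_⟩
  · rw [spectrum.mem_iff]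
    intro hu
    have hmem : shiftEigenvector b (w / c) ∈ LinearMap.ker
        ((c : ℂ) • backwardShift b - w • ContinuousLinearMap.id ℂ H).toLinearMap := by
      rw [hker w hw]
      exact Submodule.mem_span_singleton_self _
    have h0 : (algebraMap ℂ (H →L[ℂ] H) w - (c : ℂ) • backwardShift b)
        (shiftEigenvector b (w / c)) = 0 := by
      rw [← neg_sub, neg_apply, neg_eq_zero, Algebra.algebraMap_eq_smul_one]
      exact hmem
    apply shiftEigenvector_ne_zero b (hz w hw)
    have := DFunLike.congr_fun (Ring.inverse_mul_cancel _ hu) (shiftEigenvector b (w / c))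
    exact this.symm.trans (by rw [mul_apply_eq_comp, h0, map_zero])
  · rw [Submodule.topologicalClosure_eq_top_iff, Submodule.eq_bot_iff]
    intro x hx
    refine eq_zero_of_inner_shiftEigenvector_eq_zero b (U := (fun z : ℂ => c * z) ⁻¹' Ω)
      (ho.preimage (by fun_prop)) ?_ ?_ fun z hz' => ?_
    · obtain ⟨w, hw⟩ := hne
      exact ⟨w / c, by simpa [mul_div_cancel₀ _ hc'] using hw⟩
    · intro z hz'
      have := hz _ hz'
      rw [mul_div_cancel_left₀ _ hc'] at this
      simpa using this
    · refine (Submodule.mem_orthogonal' _ _).1 hx _ ?_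
      refine Submodule.mem_iSup_of_mem (c * z) (Submodule.mem_iSup_of_mem hz' ?_)
      rw [hker _ hz', mul_div_cancel_left₀ _ hc']
      exact Submodule.mem_span_singleton_self _
  · intro y
    have hu := isUnit_one_sub_smul_forwardShift b (hz w hw)
    -- As `B S = 1`, one has `(c B - w) S = c (1 - (w / c) S)`, which is invertible.
    refine ⟨forwardShift b (Ring.inverse (1 - (w / c) • forwardShift b) ((c : ℂ)⁻¹ • y)), ?_⟩
    set x := Ring.inverse (1 - (w / c) • forwardShift b) ((c : ℂ)⁻¹ • y)
    have hx : x - (w / c) • forwardShift b x = (c : ℂ)⁻¹ • y :=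
      DFunLike.congr_fun (Ring.mul_inverse_cancel _ hu) ((c : ℂ)⁻¹ • y)
    rw [sub_apply, smul_apply, smul_apply, backwardShift_forwardShift, coe_id', id_eq]
    rw [eq_inv_smul_iff₀ hc', smul_sub, smul_smul, mul_div_cancel₀ _ hc'] at hx
    exact hx
  · rw [hker w hw, Nat.cast_one, Module.rank_eq_one_iff_finrank_eq_one]
    exact finrank_span_singleton (shiftEigenvector_ne_zero b (hz w hw))

theorem unitarilyEquivalent_smul_backwardShift [CompleteSpace K] (b : HilbertBasis ℕ ℂ H)
    (b' : HilbertBasis ℕ ℂ K) (c : ℂ) :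
    UnitarilyEquivalent (c • backwardShift b) (c • backwardShift b') := by
  refine ⟨b.repr.trans b'.repr.symm, fun x => ?_⟩
  apply b'.repr.injective
  ext n
  simp [repr_backwardShift]

/-- A Hilbert space that is unitarily equivalent to a space with an orthogonal basis indexed by `ℕ`
has a Hilbert basis indexed by `ℕ`. -/
theorem CowenDouglas.IsOrthogonalBasis.nonempty_hilbertBasis {H : Type*}
    [NormedAddCommGroup H] [InnerProductSpace ℂ H] {D : Set ℂ} {HK : Type*}
    [NormedAddCommGroup HK] [InnerProductSpace ℂ HK] [CompleteSpace HK] [RKHS ℂ HK D ℂ]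
    {e : ℕ → D → ℂ} (he : IsOrthogonalBasis HK e) (U : H ≃ₗᵢ[ℂ] HK) :
    Nonempty (HilbertBasis ℕ ℂ H) := by
  obtain ⟨f, -, hne, horth, hspan⟩ := he
  have ho : Orthonormal ℂ fun n => ((‖f n‖ : ℂ)⁻¹) • f n := by
    refine ⟨fun n => ?_, fun m n hmn => ?_⟩
    · exact norm_smul_inv_norm (hne n)
    · beta_reduce
      rw [inner_smul_left, inner_smul_right, horth hmn, mul_zero, mul_zero]
  let b : HilbertBasis ℕ ℂ HK := HilbertBasis.mk ho (by
    rw [← hspan]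
    refine Submodule.topologicalClosure_mono (Submodule.span_le.2 ?_)
    rintro _ ⟨n, rfl⟩
    have h : ((‖f n‖ : ℂ)⁻¹) • f n ∈
      Submodule.span ℂ (Set.range fun n => ((‖f n‖ : ℂ)⁻¹) • f n) :=
      Submodule.subset_span ⟨n, rfl⟩
    have hn : (‖f n‖ : ℂ) ≠ 0 := by exact_mod_cast norm_ne_zero_iff.2 (hne n)
    simpa [smul_smul, hn] using Submodule.smul_mem _ (‖f n‖ : ℂ) h)
  exact ⟨HilbertBasis.ofRepr (U.trans b.repr)⟩

end Shift


/-! ### The main theorem -/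

theorem corollary3p3
    (Ω : Set ℂ) (hΩ_open : IsOpen Ω) (hΩ_conn : IsConnected Ω)
    {H₀ H₁ : Type*}
    [NormedAddCommGroup H₀] [InnerProductSpace ℂ H₀] [CompleteSpace H₀]
    [TopologicalSpace.SeparableSpace H₀]
    [NormedAddCommGroup H₁] [InnerProductSpace ℂ H₁] [CompleteSpace H₁]
    [TopologicalSpace.SeparableSpace H₁]
    (T₀ : H₀ →L[ℂ] H₀) (T₁ : H₁ →L[ℂ] H₁)
    (hT₀ : CowenDouglas.MemB 1 Ω T₀) (hT₁ : CowenDouglas.MemB 1 Ω T₁)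
    -- the function spaces of the two kernels
    {HK₀ HK₁ : Type*}
    [NormedAddCommGroup HK₀] [InnerProductSpace ℂ HK₀] [CompleteSpace HK₀]
    [RKHS ℂ HK₀ (CowenDouglas.conjDomain Ω) ℂ]
    [NormedAddCommGroup HK₁] [InnerProductSpace ℂ HK₁] [CompleteSpace HK₁]
    [RKHS ℂ HK₁ (CowenDouglas.conjDomain Ω) ℂ]
    (hmodel₀ : CowenDouglas.IsAdjointMulModel HK₀ T₀)
    (hmodel₁ : CowenDouglas.IsAdjointMulModel HK₁ T₁)
    (e : ℕ → CowenDouglas.conjDomain Ω → ℂ) (α β : ℕ → ℂ)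
    (he₀ : CowenDouglas.IsOrthogonalBasis HK₀ e)
    (he₁ : CowenDouglas.IsOrthogonalBasis HK₁ e)
    (hK₀ : CowenDouglas.HasDiagonalKernel HK₀ e α)
    (hK₁ : CowenDouglas.HasDiagonalKernel HK₁ e β)
    (hblow₀ : CowenDouglas.KernelBlowsUp HK₀)
    (hblow₁ : CowenDouglas.KernelBlowsUp HK₁) :
    -- an operator, realized on `H₀` and on `H₁`, that has no nonzero intertwiners
    (∃ (S₀ : H₀ →L[ℂ] H₀) (S₁ : H₁ →L[ℂ] H₁),
      CowenDouglas.UnitarilyEquivalent S₀ S₁ ∧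
      CowenDouglas.MemB 1 Ω S₀ ∧ CowenDouglas.MemB 1 Ω S₁ ∧
      LinearMap.ker (CowenDouglas.tau T₀ S₀) = ⊥ ∧
      LinearMap.ker (CowenDouglas.tau T₁ S₁) = ⊥ ∧
      LinearMap.ker (CowenDouglas.tau T₁ S₀) = ⊥ ∧
      LinearMap.ker (CowenDouglas.tau T₀ S₁) = ⊥) ∧
    -- `J` is any identification of `H₀` with `H₁`
    (∀ (J : H₀ ≃ₗᵢ[ℂ] H₁) (X Y : H₁ →L[ℂ] H₀) (t₀ : ℂ → H₀) (t₁ : ℂ → H₁),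
      Isometry X →
      CowenDouglas.IsHolomorphicFrame Ω T₀ t₀ →
      CowenDouglas.IsHolomorphicFrame Ω T₁ t₁ →
      (∀ w ∈ Ω, ContinuousLinearMap.adjoint X (t₀ w) = (2 : ℂ) • J (Y (t₁ w))) →
      (∀ w ∈ Ω, ‖t₀ w‖ ^ 2 = 2 * (‖Y (t₁ w)‖ ^ 2 + ‖t₁ w‖ ^ 2)) →
      CowenDouglas.Similar T₀ T₁) := by
  constructor
  · obtain ⟨-, M₀, -, U₀, -⟩ := hmodel₀
    obtain ⟨-, M₁, -, U₁, -⟩ := hmodel₁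
    obtain ⟨b₀⟩ := he₀.nonempty_hilbertBasis U₀
    obtain ⟨b₁⟩ := he₁.nonempty_hilbertBasis U₁
    have hΩb : ∃ R : ℝ, ∀ w ∈ Ω, ‖w‖ ≤ R :=
      ⟨_, fun w hw => spectrum.norm_le_norm_mul_of_mem (hT₀.subset_spectrum hw)⟩
    obtain ⟨R, hR⟩ := hΩb
    set r : ℝ := max R (max ‖T₀‖ ‖T₁‖)
    have hr₀ : ‖T₀‖ ≤ r := (le_max_left _ _).trans (le_max_right _ _)
    have hr₁ : ‖T₁‖ ≤ r := (le_max_right _ _).trans (le_max_right _ _)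
    have hr : 0 ≤ r := (norm_nonneg _).trans hr₀
    have hc : 0 < r + 1 := by linarith
    have hΩc : Ω ⊆ Metric.ball 0 (r + 1) := fun w hw => by
      rw [mem_ball_zero_iff]
      linarith [hR w hw, le_max_left R (max ‖T₀‖ ‖T₁‖)]
    -- On this annulus neither `T₀` nor `T₁` has eigenvalues, while the scaled shift still has a
    -- total set of eigenvectors.
    let A : Set ℂ := {w | r < ‖w‖} ∩ Metric.ball 0 (r + 1)
    have hAo : IsOpen A := (isOpen_lt continuous_const continuous_norm).inter Metric.isOpen_ball
    have hAne : A.Nonempty := by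
      refine ⟨((r + 1 / 2 : ℝ) : ℂ), ?_, ?_⟩
      · rw [Set.mem_ofPred_eq, Complex.norm_real, Real.norm_of_nonneg (by linarith)]
        linarith
      · rw [mem_ball_zero_iff, Complex.norm_real, Real.norm_of_nonneg (by linarith)]
        linarith
    have hA₀ := memB_smul_backwardShift b₀ hc hAo hAne Set.inter_subset_right
    have hA₁ := memB_smul_backwardShift b₁ hc hAo hAne Set.inter_subset_right
    exact ⟨_, _, unitarilyEquivalent_smul_backwardShift b₀ b₁ ((r + 1 : ℝ) : ℂ),
      memB_smul_backwardShift b₀ hc hΩ_open hΩ_conn.nonempty hΩc,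
      memB_smul_backwardShift b₁ hc hΩ_open hΩ_conn.nonempty hΩc,
      ker_tau_eq_bot_of_norm_lt hA₀ fun w hw => hr₀.trans_lt hw.1,
      ker_tau_eq_bot_of_norm_lt hA₁ fun w hw => hr₁.trans_lt hw.1,
      ker_tau_eq_bot_of_norm_lt hA₀ fun w hw => hr₁.trans_lt hw.1,
      ker_tau_eq_bot_of_norm_lt hA₁ fun w hw => hr₀.trans_lt hw.1⟩
  · intro J X Y t₀ t₁ _ ht₀ ht₁ _ hnorm
    exact similar_of_norm_sq_eq hΩ_open hΩ_conn hT₀ hT₁ ht₀ ht₁ Y hnorm
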